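/- Let $G=(V,E)$ be a finite directed acyclic graph in which parallel channels are allowed, with a source node $s$ and a set $T\subseteq V\setminus\{s\}$ of $l=|T|$ sink nodes. Let $J=V\setminus(\{s\}\cup T)$ be the set of internal nodes, and for $t\in T$ let $C_t$ be the minimum cut capacity between $s$ and $t$, every channel having capacity $1$. Let $w$ be an integer with $0\le w\le C_t$ for all $t\in T$, and let $\mathcal F$ be a finite field. For a node $v$, let $In(v)$ be the set of channels ending at $v$, where $In(s)$ moreover contains $w$ imaginary channels $d_1,\dots,d_w$ whose kernels $f_{d_1},\dots,f_{d_w}$ are the standard basis vectors of $\mathcal F^w$. In random linear network coding, the local encoding coefficients $k_{d,e}$ (one for each $e\in E$ and each $d\in In(\mathrm{tail}(e))$) are independent and uniformly distributed over $\mathcal F$, and the global encoding kernels $f_e\in\mathcal F^w$ are determined by $f_e=\sum_{d\in In(\mathrm{tail}(e))}k_{d,e}f_d$. For $t\in T$ let $F_t=(f_e:\ e\in In(t))$ be the matrix whose columns are these kernels, and let $$P_e=\Pr\bigl(\exists\, t\in T:\ \mathrm{Rank}(F_t)<w\bigr).$$ Put $a=1-\prod_{h=1}^{w}\bigl(1-|\mathcal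 F|^{-h}\bigr)$. Then for every integer $m\ge |J|$ such that $la\le 1$ (this condition is not needed if $m=0$ or $m$ is odd), $$P_e\le 1-(1-a)^{l}(1-la)^{m}.$$ In particular, under the same condition for $m=|J|$, $$P_e\le 1-(1-a)^{|T|}(1-la)^{|J|}.$$ -/

import Mathlib

/-- A single-source multicast network with unit-capacity channels: a directed acyclic graph with
node type `V` and channel type `E` (parallel channels are allowed), a source node, and a set of
sink nodes not containing the source. -/
structure CodingNetwork (V E : Type*) where
  /-- the node at which a channel starts -/
  tail : E → V
  /-- the node at which a channel ends -/
  head : E → V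
  /-- there is no directed cycle -/
  acyclic : ∀ v : V, ¬ Relation.TransGen (fun x y => ∃ e : E, tail e = x ∧ head e = y) v v
  /-- the source node `s` -/
  source : V
  /-- the set `T` of sink nodes -/
  sinks : Finset V
  source_notMem_sinks : source ∉ sinks

namespace CodingNetwork

variable {V E : Type*} (N : CodingNetwork V E)

/-- The set `J` of internal nodes: the nodes that are neither the source nor a sink. -/
def internalNodes [Fintype V] [DecidableEq V] : Finset V :=
  Finset.univ.filter fun v => v ≠ N.source ∧ v ∉ N.sinks

/-- The capacity of the cut given by a set `U` of nodes: the number of channels leaving `U`. -/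
def cutCapacity [Fintype E] [DecidableEq V] (U : Finset V) : ℕ :=
  (Finset.univ.filter fun e : E => N.tail e ∈ U ∧ N.head e ∉ U).card

/-- The minimum cut capacity `C_t` between the source and the node `t` (used for `t ≠ s`). -/
noncomputable def minCut [Fintype E] [DecidableEq V] (t : V) : ℕ :=
  sInf {c : ℕ | ∃ U : Finset V, N.source ∈ U ∧ t ∉ U ∧ N.cutCapacity U = c}

/-- The node at which a channel ends, where `Sum.inr e` is the channel `e` of the network and
`Sum.inl 1, …, Sum.inl w` are the `w` imaginary channels, which feed the source messages into the
source node. -/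
def extHead (w : ℕ) : Fin w ⊕ E → V :=
  Sum.elim (fun _ => N.source) N.head

/-- `In(v)`, the incoming channels of the node `v` (for `v = s`, with the imaginary channels). -/
abbrev In (w : ℕ) (v : V) : Type _ := {d : Fin w ⊕ E // N.extHead w d = v}

/-- A choice of all local encoding coefficients `k_{d,e}`, for the channels `e` and the incoming
channels `d` of the tail of `e`; the coefficient `k_{d,e}` is `k e d`. -/
abbrev LocalCoding (F : Type*) (w : ℕ) : Type _ :=
  (e : E) → N.In w (N.tail e) → F

theorem wellFounded_adj [Finite E] :
    WellFounded fun d e : E => N.head d = N.tail e := by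
  let r : E → E → Prop := Relation.TransGen fun d e : E => N.head d = N.tail e
  have key : ∀ d e : E, r d e →
      Relation.TransGen (fun x y => ∃ e : E, N.tail e = x ∧ N.head e = y) (N.tail d) (N.tail e) := by
    intro d e h
    induction h with
    | single h => exact .single ⟨d, rfl, h⟩
    | tail _ h ih => exact ih.tail ⟨_, rfl, h⟩
  have : IsTrans E r := ⟨fun _ _ _ h₁ h₂ => h₁.trans h₂⟩
  have : Std.Irrefl r := ⟨fun e h => N.acyclic _ (key e e h)⟩
  have hr : WellFounded r := Finite.wellFounded_of_trans_of_irrefl r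
  exact Subrelation.wf (r := r) (fun h => Relation.TransGen.single h) hr

section Kernels

variable [Fintype E] [DecidableEq V] {F : Type*} [Field F] {w : ℕ}

/-- The global encoding kernels `f_e` of the channels of the network, determined by the local
encoding coefficients through `f_e = ∑_{d ∈ In(tail e)} k_{d,e} f_d`, where the kernels of the `w`
imaginary channels are the standard basis vectors (see `globalKernel_inr`). -/
noncomputable def realKernel (k : N.LocalCoding F w) : E → Fin w → F :=
  N.wellFounded_adj.fix fun e f =>
    ∑ d : N.In w (N.tail e), k e d •
      (match d with
        | ⟨Sum.inl j, _⟩ => Pi.single j 1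
        | ⟨Sum.inr d', h⟩ => f d' h)

/-- The global encoding kernels of all channels, including the imaginary ones. -/
noncomputable def globalKernel (k : N.LocalCoding F w) : Fin w ⊕ E → Fin w → F :=
  Sum.elim (fun j => Pi.single j 1) (N.realKernel k)

theorem globalKernel_inl (k : N.LocalCoding F w) (j : Fin w) :
    N.globalKernel k (Sum.inl j) = Pi.single j 1 := rfl

theorem globalKernel_inr (k : N.LocalCoding F w) (e : E) :
    N.globalKernel k (Sum.inr e) =
      ∑ d : N.In w (N.tail e), k e d • N.globalKernel k d.1 := by
  change N.realKernel k e = _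
  rw [realKernel, WellFounded.fix_eq]
  refine Finset.sum_congr rfl fun d _ => ?_
  rcases d with ⟨j | d, h⟩ <;> rfl

/-- The decoding matrix `F_t = (f_e : e ∈ In(t))`. -/
noncomputable def decodingMatrix (k : N.LocalCoding F w) (t : V) :
    Matrix (Fin w) (N.In w t) F :=
  Matrix.of fun i d => N.globalKernel k d.1 i

end Kernels

/-- The failure probability `P_e` of random linear network coding with information rate `w` over
the finite field `F`: the probability that `Rank(F_t) < w` for at least one sink `t`, when the local
encoding coefficients are independent and uniformly distributed over `F`, that is, when the
family of all coefficients is uniformly distributed over all families. -/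
noncomputable def failureProb [Fintype E] [DecidableEq E] [DecidableEq V]
    (F : Type*) [Field F] [Fintype F] (w : ℕ) : ℝ :=
  ((PMF.uniformOfFintype (N.LocalCoding F w)).toOuterMeasure
    {k | ∃ t ∈ N.sinks, (N.decodingMatrix k t).rank < w}).toReal

end CodingNetwork

/-- The number `a = 1 - ∏_{h=1}^{w} (1 - 1 / q^h)`, for a field with `q` elements. -/
noncomputable def codingLoss (q w : ℕ) : ℝ :=
  1 - ∏ h ∈ Finset.Icc 1 w, (1 - 1 / (q : ℝ) ^ h)

/-! The obstacle is that sinks may also send: a channel leaving a sink can serve another sink, and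
sinks are not to be paid for as coding nodes. To remove them, fix surjections `π v` onto `F^w` at
the source and at every sink, and let each channel leaving such a node `v` carry `π v (k e)` instead
of its true kernel. The sinks then act as further copies of the source. If all sinks decode in this
modified network, the true encoding maps at these nodes are surjective as well, so they differ from
`π v` only by automorphisms of the coefficient spaces. Applying these automorphisms injects the good
outcomes of the modified network into those of the original one (`unifProb_resetGlobalKernel_le`),
so a lower bound for the modified success probability suffices.

With the sinks merged, as senders, into the source, the cut condition still gives a unit flow of
value `w` to each sink (`exists_isSinkFlow`). The source and the internal nodes are visited in
topological order, and for each sink one asks that the kernels on the flow channels leaving the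
visited set span `F^w`. Passing a node replaces incoming flow channels by at least as many fresh
random ones, which preserves spanning with probability at least `1 - a`
(`IsSinkFlow.le_unifProb_spans_insert`).

There are `|J| + 1` nodes to visit. At each of the first `|J|` the union bound over the sinks costs
a factor `1 - la` (`IsInitial.pow_card_le_unifProb`). After the last one every outgoing flow channel
enters its own sink, so the sinks use disjoint sets of coefficients and the factor is `(1 - a)^l`
(`IsInitial.pow_mul_unifProb_le`). -/

open Classical in
/-- The probability of an event under the uniform distribution on a finite type. -/
noncomputable def unifProb {Ω : Type*} [Fintype Ω] (p : Ω → Prop) : ℝ :=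
  ((Finset.univ.filter p).card : ℝ) / Fintype.card Ω

/-! ### Uniform probabilities and resampling -/

section UnifProb

variable {Ω : Type*} [Fintype Ω]

theorem unifProb_eq_div (p : Ω → Prop) [DecidablePred p] :
    unifProb p = ((Finset.univ.filter p).card : ℝ) / Fintype.card Ω := by
  unfold unifProb
  congr!

theorem unifProb_nonneg (p : Ω → Prop) : 0 ≤ unifProb p := by
  unfold unifProb; positivity

theorem unifProb_mono {p p' : Ω → Prop} (h : ∀ ω, p ω → p' ω) : unifProb p ≤ unifProb p' := by
  classical
  unfold unifProb
  refine div_le_div_of_nonneg_right (Nat.cast_le.2 (Finset.card_le_card ?_)) (Nat.cast_nonneg _)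
  intro ω hω
  simpa using h ω (by simpa using hω)

theorem unifProb_of_forall [Nonempty Ω] {p : Ω → Prop} (h : ∀ ω, p ω) : unifProb p = 1 := by
  classical
  unfold unifProb
  rw [Finset.filter_true_of_mem fun ω _ => h ω, Finset.card_univ]
  exact div_self (Nat.cast_ne_zero.2 Fintype.card_ne_zero)

theorem unifProb_not [Nonempty Ω] (p : Ω → Prop) :
    unifProb (fun ω => ¬ p ω) = 1 - unifProb p := by
  classical
  have hΩ : (Fintype.card Ω : ℝ) ≠ 0 := Nat.cast_ne_zero.2 Fintype.card_ne_zero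
  have h := Finset.card_filter_add_card_filter_not (s := (Finset.univ : Finset Ω)) p
  rw [Finset.card_univ] at h
  rw [unifProb_eq_div, unifProb_eq_div, eq_sub_iff_add_eq, ← add_div, div_eq_one_iff_eq hΩ, add_comm]
  exact_mod_cast h

theorem unifProb_exists_le {ι : Type*} (s : Finset ι) (p : ι → Ω → Prop) :
    unifProb (fun ω => ∃ i ∈ s, p i ω) ≤ ∑ i ∈ s, unifProb (p i) := by
  classical
  have : Finset.univ.filter (fun ω => ∃ i ∈ s, p i ω) =
      s.biUnion fun i => Finset.univ.filter (p i) := by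
    ext ω; simp
  simp_rw [unifProb_eq_div]
  rw [← Finset.sum_div, this]
  refine div_le_div_of_nonneg_right ?_ (Nat.cast_nonneg _)
  exact_mod_cast Finset.card_biUnion_le

/-- The union bound for the complements of finitely many events. -/
theorem one_sub_card_mul_le_unifProb_forall [Nonempty Ω] {ι : Type*} (s : Finset ι)
    (p : ι → Ω → Prop) {a : ℝ} (h : ∀ i ∈ s, 1 - a ≤ unifProb (p i)) :
    1 - s.card * a ≤ unifProb (fun ω => ∀ i ∈ s, p i ω) := by
  have h₁ := unifProb_exists_le s fun i ω => ¬ p i ω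
  have h₂ : ∑ i ∈ s, unifProb (fun ω => ¬ p i ω) ≤ ∑ _i ∈ s, a := by
    refine Finset.sum_le_sum fun i hi => ?_
    rw [unifProb_not]
    linarith [h i hi]
  rw [Finset.sum_const, nsmul_eq_mul] at h₂
  have h₃ := unifProb_not fun ω => ∀ i ∈ s, p i ω
  have h₄ : unifProb (fun ω => ¬ ∀ i ∈ s, p i ω) ≤ unifProb (fun ω => ∃ i ∈ s, ¬ p i ω) :=
    unifProb_mono fun ω hω => by push Not at hω; exact hω
  linarith

theorem unifProb_le_of_injOn {p p' : Ω → Prop} (Θ : Ω → Ω) (hΘ : ∀ ω, p ω → p' (Θ ω))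
    (hinj : Set.InjOn Θ {ω | p ω}) : unifProb p ≤ unifProb p' := by
  classical
  unfold unifProb
  refine div_le_div_of_nonneg_right (Nat.cast_le.2 ?_) (Nat.cast_nonneg _)
  refine Finset.card_le_card_of_injOn Θ (fun ω hω => ?_) (fun ω hω ω' hω' h => ?_)
  · simpa using hΘ ω (by simpa using hω)
  · exact hinj (by simpa using hω) (by simpa using hω') h

/-- Surjective homomorphisms preserve uniform distributions. -/
theorem unifProb_comp_of_surjective [AddCommGroup Ω] {Y : Type*} [AddCommGroup Y] [Fintype Y]
    (Λ : Ω →+ Y) (hΛ : Function.Surjective Λ) (p : Y → Prop) :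
    unifProb (fun ω => p (Λ ω)) = unifProb p := by
  classical
  have hfib (y : Y) : (Finset.univ.filter fun ω => Λ ω = y).card
      = (Finset.univ.filter fun ω => Λ ω = 0).card := by
    obtain ⟨ω₀, rfl⟩ := hΛ y
    refine Finset.card_bij' (fun ω _ => ω - ω₀) (fun ω _ => ω + ω₀) ?_ ?_ ?_ ?_ <;>
      simp +contextual
  set c := (Finset.univ.filter fun ω => Λ ω = 0).card with hc
  have hcard (p : Y → Prop) : (Finset.univ.filter fun ω => p (Λ ω)).card
      = (Finset.univ.filter p).card * c := by
    rw [Finset.card_eq_sum_card_fiberwise (f := Λ) (t := Finset.univ.filter p)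
      (fun ω hω => by simpa using hω), Finset.sum_const_nat]
    intro y hy
    rw [← hfib y, Finset.filter_filter]
    congr 1
    ext ω
    simp only [Finset.mem_filter, Finset.mem_univ, true_and] at hy ⊢
    exact ⟨fun h => h.2, fun h => ⟨h ▸ hy, h⟩⟩
  have hΩ : Fintype.card Ω = Fintype.card Y * c := by
    simpa using hcard fun _ => True
  have hc0 : (c : ℝ) ≠ 0 := by
    intro h
    have : Fintype.card Ω = 0 := by rw [hΩ, Nat.cast_eq_zero.1 h, mul_zero]
    exact (Fintype.card_ne_zero (α := Ω)) this
  rw [unifProb_eq_div, unifProb_eq_div, hcard, hΩ]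
  push_cast
  rw [mul_div_mul_right _ _ hc0]

end UnifProb

/-- If the event `G` is not affected by resampling the coordinates in `B`, and `G'` has probability
at least `c` after resampling from any outcome in `G`, then `G ∧ G'` has probability at least `c`
times that of `G`. -/
theorem mul_unifProb_le_unifProb_and {E : Type*} [Fintype E] [DecidableEq E] {X : E → Type*}
    [∀ e, Fintype (X e)] [∀ e, Nonempty (X e)] (B : Set E)
    [∀ e, Decidable (e ∈ B)] {G G' : (∀ e, X e) → Prop} {c : ℝ}
    (hG : ∀ ω ω', G ω → G (B.piecewise ω' ω))
    (h : ∀ ω, G ω → c ≤ unifProb fun ω' => G' (B.piecewise ω' ω)) :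
    c * unifProb G ≤ unifProb fun ω => G ω ∧ G' ω := by
  classical
  let Ω := ∀ e, X e
  have hΩ : (0 : ℝ) < Fintype.card Ω := Nat.cast_pos.2 Fintype.card_pos
  -- Exchanging the `B`-coordinates of two independent samples is a bijection of `Ω × Ω`, so the
  -- resampled outcome is again uniform.
  have hinv : Function.Involutive fun x : Ω × Ω => (B.piecewise x.2 x.1, B.piecewise x.1 x.2) := by
    intro x
    ext e <;> by_cases he : e ∈ B <;> simp [he]
  have h₁ : c * (Finset.univ.filter G).card * Fintype.card Ω ≤
      ((Finset.univ.filter fun x : Ω × Ω => G x.1 ∧ G' (B.piecewise x.2 x.1)).card : ℝ) := by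
    rw [Finset.card_eq_sum_card_fiberwise (f := Prod.fst) (t := Finset.univ.filter G)
      (fun x hx => by
        have := (Finset.mem_filter.1 hx).2.1
        simpa using this)]
    push_cast
    rw [mul_comm c, mul_assoc, ← nsmul_eq_mul, ← Finset.sum_const]
    refine Finset.sum_le_sum fun ω hω => ?_
    have hω' := (Finset.mem_filter.1 hω).2
    have h₂ := h ω hω'
    unfold unifProb at h₂
    rw [le_div_iff₀ hΩ] at h₂
    refine h₂.trans ?_
    norm_cast
    refine Finset.card_le_card_of_injOn (fun ω' => (ω, ω')) (fun ω' h => ?_) (fun _ _ _ _ h => ?_)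
    · have : G' (B.piecewise ω' ω) := by simpa using h
      simp [hω', this]
    · exact (Prod.mk.inj h).2
  have h₂ : (Finset.univ.filter fun x : Ω × Ω => G x.1 ∧ G' (B.piecewise x.2 x.1)).card ≤
      (Finset.univ.filter fun x : Ω × Ω => G x.1 ∧ G' x.1).card := by
    refine Finset.card_le_card_of_injOn _ (fun x hx => ?_) hinv.injective.injOn
    have hx' := (Finset.mem_filter.1 hx).2
    simp only [Finset.coe_filter, Finset.mem_univ, true_and, Set.mem_ofPred_eq]
    exact ⟨hG _ _ hx'.1, hx'.2⟩
  have h₃ : (Finset.univ.filter fun x : Ω × Ω => G x.1 ∧ G' x.1).card =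
      (Finset.univ.filter fun ω => G ω ∧ G' ω).card * Fintype.card Ω := by
    rw [← Finset.card_univ, ← Finset.card_product]
    congr 1
    ext x
    simp
  unfold unifProb
  rw [mul_div_assoc', div_le_div_iff_of_pos_right hΩ]
  refine le_of_mul_le_mul_right (h₁.trans ?_) hΩ
  rw [← Nat.cast_mul, Nat.cast_le]
  exact (h₂.trans h₃.le).trans_eq (by congr!)

/-! ### Random vectors spanning modulo a subspace -/

section Spanning

variable {F : Type*} [Field F] [Fintype F]

theorem unifProb_linearIndependent {Q : Type*} [AddCommGroup Q] [Module F Q] [Fintype Q] {d : ℕ}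
    (hd : Module.finrank F Q = d) :
    unifProb (fun v : Fin d → Q => LinearIndependent F v) =
      ∏ h ∈ Finset.Icc 1 d, (1 - 1 / (Fintype.card F : ℝ) ^ h) := by
  classical
  have hq : (0 : ℝ) < Fintype.card F := Nat.cast_pos.2 Fintype.card_pos
  have hcard := card_linearIndependent (K := F) (V := Q) (k := d) hd.ge
  rw [hd, Nat.card_eq_fintype_card, Fintype.card_subtype] at hcard
  rw [unifProb_eq_div, hcard, Fintype.card_fun, Fintype.card_fin,
    Module.card_eq_pow_finrank (K := F) (V := Q), hd,
    Fin.prod_univ_eq_prod_range (fun i => Fintype.card F ^ d - Fintype.card F ^ i) d]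
  have hden : (((Fintype.card F ^ d) ^ d : ℕ) : ℝ) =
      ∏ _i ∈ Finset.range d, (Fintype.card F : ℝ) ^ d := by simp
  -- The factor `(q^d - q^i) / q^d` equals `1 - 1 / q^(d-i)`; reflecting the range turns `d - i`
  -- into `h = 1, …, d`.
  rw [hden, Nat.cast_prod, ← Finset.prod_div_distrib, ← Finset.prod_range_reflect,
    ← Finset.Ico_add_one_right_eq_Icc, Finset.prod_Ico_eq_prod_range, Nat.add_sub_cancel]
  refine Finset.prod_congr rfl fun j hj => ?_
  have hj := Finset.mem_range.1 hj
  rw [Nat.cast_sub (Nat.pow_le_pow_right Fintype.card_pos (by omega)), Nat.cast_pow, Nat.cast_pow,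
    sub_div, div_self (by positivity)]
  congr 1
  rw [div_eq_div_iff (by positivity) (by positivity), ← pow_add, one_mul]
  congr 1
  omega

theorem one_sub_inv_pow_mem_Icc (h : ℕ) :
    1 - 1 / (Fintype.card F : ℝ) ^ h ∈ Set.Icc (0 : ℝ) 1 := by
  have hq : (1 : ℝ) ≤ Fintype.card F := Nat.one_le_cast.2 Fintype.card_pos
  have h₁ : 1 / (Fintype.card F : ℝ) ^ h ≤ 1 := div_le_one_of_le₀ (one_le_pow₀ hq) (by positivity)
  have h₂ : 0 ≤ 1 / (Fintype.card F : ℝ) ^ h := by positivity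
  exact ⟨by linarith, by linarith⟩

variable (F) in
theorem codingLoss_mem_Icc (w : ℕ) : codingLoss (Fintype.card F) w ∈ Set.Icc (0 : ℝ) 1 := by
  have h₁ := Finset.prod_nonneg (s := Finset.Icc 1 w) fun h _ => (one_sub_inv_pow_mem_Icc (F := F) h).1
  have h₂ := Finset.prod_le_one (s := Finset.Icc 1 w)
    (fun h _ => (one_sub_inv_pow_mem_Icc (F := F) h).1)
    fun h _ => (one_sub_inv_pow_mem_Icc (F := F) h).2
  unfold codingLoss
  exact ⟨by linarith, by linarith⟩

variable (F) in
-- All factors lie in `[0, 1]`, so dropping some only increases the product. Hence the same `a`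
-- serves for every codimension `d` that occurs.
theorem one_sub_codingLoss_le {d w : ℕ} (hdw : d ≤ w) :
    1 - codingLoss (Fintype.card F) w ≤
      ∏ h ∈ Finset.Icc 1 d, (1 - 1 / (Fintype.card F : ℝ) ^ h) := by
  unfold codingLoss
  rw [sub_sub_cancel]
  exact Finset.prod_le_prod_of_subset_of_le_one (Finset.Icc_subset_Icc_right hdw)
    (fun h _ => (one_sub_inv_pow_mem_Icc (F := F) h).1)
    fun h _ _ => (one_sub_inv_pow_mem_Icc (F := F) h).2

/-- Random vectors `M e (ω e)` span modulo a subspace `Z` of small codimension with the probability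
with which a random square matrix is invertible. -/
theorem le_unifProb_sup_span_eq_top {E : Type*} [Fintype E] [DecidableEq E] {X : E → Type*}
    [∀ e, AddCommGroup (X e)] [∀ e, Module F (X e)] [∀ e, Fintype (X e)]
    {W : Type*} [AddCommGroup W] [Module F W] [Fintype W] (Z : Submodule F W) (O : Finset E)
    (M : ∀ e, X e →ₗ[F] W) (hM : ∀ e ∈ O, Z ⊔ LinearMap.range (M e) = ⊤)
    (hZ : Module.finrank F (W ⧸ Z) ≤ O.card) :
    1 - codingLoss (Fintype.card F) (Module.finrank F W) ≤
      unifProb fun ω : ∀ e, X e =>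
        Z ⊔ Submodule.span F ((fun e => M e (ω e)) '' (O : Set E)) = ⊤ := by
  classical
  refine (one_sub_codingLoss_le F Z.finrank_quotient_le).trans ?_
  -- Surplus vectors are discarded, leaving as many as the codimension `d` of `Z`. Modulo `Z` they
  -- are independent and uniform, since each `M e` maps onto the quotient; spanning then means that
  -- a random `d × d` matrix is invertible.
  obtain ⟨O', hO', hcard⟩ := Finset.exists_subset_card_eq hZ
  set d := Module.finrank F (W ⧸ Z) with hd
  let o : Fin d ≃ O' := (Fintype.equivFinOfCardEq (by simpa using hcard)).symm
  let Λ : (∀ e, X e) →ₗ[F] (Fin d → W ⧸ Z) :=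
    LinearMap.pi fun i => Z.mkQ ∘ₗ M (o i) ∘ₗ LinearMap.proj (o i : E)
  have hΛ : Function.Surjective Λ := by
    intro y
    have hy (e : O') : ∃ x : X e, Z.mkQ (M e x) = y (o.symm e) := by
      obtain ⟨v, hv⟩ := Z.mkQ_surjective (y (o.symm e))
      have : v ∈ Z ⊔ LinearMap.range (M e) := by
        rw [hM _ (hO' e.2)]; trivial
      obtain ⟨z, hz, _, ⟨x, rfl⟩, rfl⟩ := Submodule.mem_sup.1 this
      refine ⟨x, ?_⟩
      rw [← hv, map_add, (by simpa using hz : Z.mkQ z = 0), zero_add]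
    choose x hx using hy
    refine ⟨fun e => if h : e ∈ O' then x ⟨e, h⟩ else 0, funext fun i => ?_⟩
    simp [Λ, hx]
  have := Fintype.ofFinite (W ⧸ Z)
  rw [← unifProb_linearIndependent (F := F) hd.symm,
    ← unifProb_comp_of_surjective Λ.toAddMonoidHom hΛ]
  refine unifProb_mono fun ω hω => ?_
  have hspan := LinearIndependent.span_eq_top_of_card_eq_finrank' hω (by simp [hd])
  have hmap : (Submodule.span F ((fun e => M e (ω e)) '' (O : Set E))).map Z.mkQ = ⊤ := by
    rw [eq_top_iff, ← hspan, Submodule.map_span]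
    refine Submodule.span_mono ?_
    rintro _ ⟨i, rfl⟩
    exact ⟨_, ⟨o i, hO' (o i).2, rfl⟩, rfl⟩
  rw [sup_comm, ← Z.ker_mkQ, ← Submodule.comap_map_eq, hmap, Submodule.comap_top]

end Spanning

/-! ### Max-flow min-cut for unit capacities -/

section UnitFlow

variable {V E : Type*} [DecidableEq V]

/-- The number of channels of `A` leaving `v` minus the number of those entering `v`. -/
def netOut (tail head : E → V) (A : Finset E) (v : V) : ℤ :=
  ∑ e ∈ A, ((if tail e = v then 1 else 0) - (if head e = v then 1 else 0))

theorem netOut_eq_card_sub_card (tail head : E → V) (A : Finset E) (v : V) :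
    netOut tail head A v =
      ((A.filter fun e => tail e = v).card : ℤ) - (A.filter fun e => head e = v).card := by
  simp [netOut, Finset.sum_sub_distrib]

theorem sum_netOut (tail head : E → V) (A : Finset E) (U : Finset V) :
    ∑ v ∈ U, netOut tail head A v =
      ∑ e ∈ A, ((if tail e ∈ U then 1 else 0) - (if head e ∈ U then 1 else 0)) := by
  unfold netOut
  rw [Finset.sum_comm]
  simp [Finset.sum_sub_distrib]

/-- Augmentation of a unit-capacity flow whose value is below the capacity of all cuts. -/
theorem exists_augmented_flow [Fintype V] [DecidableEq E] {tail head : E → V} {B A : Finset E} {s t : V} {k : ℕ}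
    (hcut : ∀ U : Finset V, s ∈ U → t ∉ U →
      k < (B.filter fun e => tail e ∈ U ∧ head e ∉ U).card)
    (hAB : A ⊆ B) (hA : ∀ v, netOut tail head A v =
      (if v = s then (k : ℤ) else 0) - (if v = t then (k : ℤ) else 0)) :
    ∃ A' ⊆ B, ∀ v, netOut tail head A' v = netOut tail head A v +
      (if v = s then 1 else 0) - (if v = t then 1 else 0) := by
  -- Every node of `U` can be reached by an augmenting change of `A` made inside `U` only. Since
  -- channels crossing the boundary of `U` keep their status, the change can be extended across any
  -- one of them.
  let p (U : Finset V) : Prop := s ∈ U ∧ ∀ x ∈ U, ∃ A' ⊆ B,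
    (∀ e, ¬ (tail e ∈ U ∧ head e ∈ U) → (e ∈ A' ↔ e ∈ A)) ∧
    ∀ v, netOut tail head A' v = netOut tail head A v +
      (if v = s then 1 else 0) - (if v = x then 1 else 0)
  have hp : p {s} := by
    refine ⟨Finset.mem_singleton_self s, fun x hx => ⟨A, hAB, fun _ _ => Iff.rfl, fun v => ?_⟩⟩
    rw [Finset.mem_singleton.1 hx]
    ring
  obtain ⟨U, -, ⟨hsU, hU⟩, hmax⟩ := (Set.toFinite {U | p U}).exists_le_maximal hp
  by_cases htU : t ∈ U
  · obtain ⟨A', h₁, -, h₂⟩ := hU t htU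
    exact ⟨A', h₁, h₂⟩
  exfalso
  have hgrow (y : V) (hy : y ∉ U) (A' : Finset E) (hA' : A' ⊆ B)
      (h₁ : ∀ e, ¬ (tail e ∈ insert y U ∧ head e ∈ insert y U) → (e ∈ A' ↔ e ∈ A))
      (h₂ : ∀ v, netOut tail head A' v = netOut tail head A v +
        (if v = s then 1 else 0) - (if v = y then 1 else 0)) : False := by
    refine hy (hmax (y := insert y U) ⟨Finset.mem_insert_of_mem hsU, fun x hx => ?_⟩
      (Finset.subset_insert _ _) (Finset.mem_insert_self _ _))
    rcases Finset.mem_insert.1 hx with rfl | hx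
    · exact ⟨A', hA', h₁, h₂⟩
    · obtain ⟨A'', h₃, h₄, h₅⟩ := hU x hx
      exact ⟨A'', h₃, fun e he => h₄ e fun h => he
        ⟨Finset.mem_insert_of_mem h.1, Finset.mem_insert_of_mem h.2⟩, h₅⟩
  -- By maximality no augmentation crosses the boundary of `U`: outgoing channels are saturated, and
  -- by `hin` incoming ones are unused. The flow value `k` would then equal the capacity of the cut
  -- `U`.
  have hout : ∀ e ∈ B, tail e ∈ U → head e ∉ U → e ∈ A := by
    intro e heB ht hh
    by_contra heA
    obtain ⟨A', h₁, h₂, h₃⟩ := hU _ ht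
    have heA' : e ∉ A' := fun h => heA ((h₂ e fun h => hh h.2).1 h)
    refine hgrow (head e) hh (insert e A') (Finset.insert_subset heB h₁) (fun d hd => ?_)
      fun v => ?_
    · have hde : d ≠ e := by
        rintro rfl
        exact hd ⟨Finset.mem_insert_of_mem ht, Finset.mem_insert_self _ _⟩
      rw [Finset.mem_insert, or_iff_right hde]
      exact h₂ d fun h => hd ⟨Finset.mem_insert_of_mem h.1, Finset.mem_insert_of_mem h.2⟩
    · have := h₃ v
      rw [netOut, Finset.sum_insert heA', ← netOut, this]
      simp only [eq_comm (a := v)]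
      ring
  have hin : ∀ e ∈ A, head e ∈ U → tail e ∈ U := by
    intro e heA hh
    by_contra ht
    obtain ⟨A', h₁, h₂, h₃⟩ := hU _ hh
    have heA' : e ∈ A' := (h₂ e fun h => ht h.1).2 heA
    refine hgrow (tail e) ht (A'.erase e) ((Finset.erase_subset _ _).trans h₁) (fun d hd => ?_)
      fun v => ?_
    · have hde : d ≠ e := by
        rintro rfl
        exact hd ⟨Finset.mem_insert_self _ _, Finset.mem_insert_of_mem hh⟩
      rw [Finset.mem_erase, and_iff_right hde]
      exact h₂ d fun h => hd ⟨Finset.mem_insert_of_mem h.1, Finset.mem_insert_of_mem h.2⟩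
    · have := h₃ v
      rw [netOut, Finset.sum_erase_eq_sub heA', ← netOut, this]
      simp only [eq_comm (a := v)]
      ring
  have h₁ : ∑ v ∈ U, netOut tail head A v = k := by
    rw [Finset.sum_congr rfl fun v _ => hA v, Finset.sum_sub_distrib]
    simp [hsU, htU]
  have h₂ : ∑ v ∈ U, netOut tail head A v =
      (B.filter fun e => tail e ∈ U ∧ head e ∉ U).card := by
    have : (B.filter fun e => tail e ∈ U ∧ head e ∉ U) =
        A.filter fun e => tail e ∈ U ∧ head e ∉ U := by
      ext e
      simp only [Finset.mem_filter]
      exact ⟨fun h => ⟨hout e h.1 h.2.1 h.2.2, h.2⟩, fun h => ⟨hAB h.1, h.2⟩⟩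
    rw [this, sum_netOut, Finset.card_filter, Nat.cast_sum]
    refine Finset.sum_congr rfl fun e he => ?_
    have := hin e he
    by_cases h₁ : tail e ∈ U <;> by_cases h₂ : head e ∈ U <;> simp_all
  have h₃ := hcut U hsU htU
  omega

/-- The max-flow min-cut theorem for unit capacities: if all cuts between `s` and `t` have capacity
at least `w`, then there is a set of channels forming a flow of value `w` from `s` to `t`. -/
theorem exists_unit_flow [Fintype V] [DecidableEq E] (tail head : E → V) (B : Finset E) (s t : V) (w : ℕ)
    (hcut : ∀ U : Finset V, s ∈ U → t ∉ U →
      w ≤ (B.filter fun e => tail e ∈ U ∧ head e ∉ U).card) :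
    ∃ A ⊆ B, ∀ v, netOut tail head A v =
      (if v = s then (w : ℤ) else 0) - (if v = t then (w : ℤ) else 0) := by
  induction w with
  | zero => exact ⟨∅, Finset.empty_subset _, fun v => by simp [netOut]⟩
  | succ k ih =>
    obtain ⟨A, hAB, hA⟩ := ih fun U hs ht => (Nat.le_succ k).trans (hcut U hs ht)
    obtain ⟨A', hAB', hA'⟩ := exists_augmented_flow hcut hAB hA
    refine ⟨A', hAB', fun v => ?_⟩
    rw [hA', hA]
    push_cast
    split_ifs <;> ring

end UnitFlow

/-- Each surjection identifies `X` with the product of `Y` and its kernel, and the two kernels have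
equal dimension. -/
theorem LinearMap.exists_linearEquiv_comp_eq {K X Y : Type*} [Field K] [AddCommGroup X] [Module K X]
    [FiniteDimensional K X] [AddCommGroup Y] [Module K Y] (f g : X →ₗ[K] Y)
    (hf : Function.Surjective f) (hg : Function.Surjective g) :
    ∃ ρ : X ≃ₗ[K] X, ∀ x, f (ρ x) = g x := by
  have key (f : X →ₗ[K] Y) (hf : Function.Surjective f) :
      ∃ φ : X ≃ₗ[K] Y × LinearMap.ker f, ∀ x, (φ x).1 = f x := by
    obtain ⟨p, hp⟩ := (LinearMap.ker f).subtype.exists_leftInverse_of_injective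
      (LinearMap.ker f).ker_subtype
    have hp' (x : LinearMap.ker f) : p x = x := LinearMap.congr_fun hp x
    refine ⟨f.equivProdOfSurjectiveOfIsCompl p (LinearMap.range_eq_top.2 hf)
      (LinearMap.range_eq_top.2 fun x => ⟨x, hp' x⟩) (LinearMap.isCompl_of_proj hp'), fun x => rfl⟩
  have : FiniteDimensional K Y := Module.Finite.of_surjective f hf
  obtain ⟨φ, hφ⟩ := key f hf
  obtain ⟨ψ, hψ⟩ := key g hg
  have hdim : Module.finrank K (LinearMap.ker f) = Module.finrank K (LinearMap.ker g) := by
    have h₁ := f.finrank_range_add_finrank_ker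
    have h₂ := g.finrank_range_add_finrank_ker
    rw [LinearMap.range_eq_top.2 hf] at h₁
    rw [LinearMap.range_eq_top.2 hg] at h₂
    omega
  let ε := LinearEquiv.ofFinrankEq _ _ hdim
  refine ⟨ψ ≪≫ₗ (LinearEquiv.refl K Y).prodCongr ε.symm ≪≫ₗ φ.symm, fun x => ?_⟩
  rw [← hφ, ← hψ]
  simp

/-! ### Reset kernels at the source and the sinks -/

namespace CodingNetwork

variable {V E : Type*} (N : CodingNetwork V E)

/-- The source node and the sink nodes. -/
def terminals [DecidableEq V] : Finset V := insert N.source N.sinks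

section

variable [Fintype E] [DecidableEq V] {F : Type*} [Field F] {w : ℕ}
  (π : ∀ v, (N.In w v → F) →ₗ[F] (Fin w → F))

/-- The kernels of the network in which the channels `e` leaving the source or a sink `v` carry
`π v (k e)` instead of a combination of the kernels of the incoming channels of `v`. -/
noncomputable def resetKernel (k : N.LocalCoding F w) : E → Fin w → F :=
  N.wellFounded_adj.fix fun e f =>
    if N.tail e ∈ N.terminals then π (N.tail e) (k e) else
    ∑ d : N.In w (N.tail e), k e d •
      (match d with
        | ⟨Sum.inl j, _⟩ => Pi.single j 1
        | ⟨Sum.inr d', h⟩ => f d' h)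

/-- The kernels `resetKernel`, extended to the imaginary channels. -/
noncomputable def resetGlobalKernel (k : N.LocalCoding F w) : Fin w ⊕ E → Fin w → F :=
  Sum.elim (fun j => Pi.single j 1) (N.resetKernel π k)

/-- The map sending local encoding coefficients of a channel leaving `v` to its kernel, if the
channels entering `v` have the kernels `f`. -/
noncomputable def encodingMap (f : Fin w ⊕ E → Fin w → F) (v : V) :
    (N.In w v → F) →ₗ[F] (Fin w → F) :=
  Fintype.linearCombination F fun d : N.In w v => f d.1

theorem range_encodingMap (f : Fin w ⊕ E → Fin w → F) (v : V) :
    LinearMap.range (N.encodingMap f v) = Submodule.span F (f '' {d | N.extHead w d = v}) := by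
  rw [encodingMap, Fintype.range_linearCombination, Set.image_eq_range]
  rfl

theorem encodingMap_congr {f f' : Fin w ⊕ E → Fin w → F} {v : V}
    (h : ∀ d, N.extHead w d = v → f d = f' d) : N.encodingMap f v = N.encodingMap f' v := by
  unfold encodingMap
  congr 1
  exact funext fun d => h d.1 d.2

theorem globalKernel_inr_eq_encodingMap (k : N.LocalCoding F w) (e : E) :
    N.globalKernel k (Sum.inr e) = N.encodingMap (N.globalKernel k) (N.tail e) (k e) := by
  rw [globalKernel_inr, encodingMap, Fintype.linearCombination_apply]

variable {π}

theorem resetGlobalKernel_inr_of_mem (k : N.LocalCoding F w) {e : E}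
    (he : N.tail e ∈ N.terminals) :
    N.resetGlobalKernel π k (Sum.inr e) = π (N.tail e) (k e) := by
  change N.resetKernel π k e = _
  rw [resetKernel, WellFounded.fix_eq, if_pos he]

theorem resetGlobalKernel_inr_of_notMem (k : N.LocalCoding F w) {e : E}
    (he : N.tail e ∉ N.terminals) :
    N.resetGlobalKernel π k (Sum.inr e) =
      N.encodingMap (N.resetGlobalKernel π k) (N.tail e) (k e) := by
  change N.resetKernel π k e = _
  rw [resetKernel, WellFounded.fix_eq, if_neg he, encodingMap, Fintype.linearCombination_apply]
  refine Finset.sum_congr rfl fun d _ => ?_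
  rcases d with ⟨j | d, h⟩ <;> rfl

/-- The kernel of a channel depends only on the coefficients of the channels upstream of it. -/
theorem resetGlobalKernel_congr {k k' : N.LocalCoding F w} (H : Set E)
    (hH : ∀ e ∈ H, N.tail e ∉ N.terminals → ∀ d, N.head d = N.tail e → d ∈ H)
    (hk : ∀ e ∈ H, k e = k' e) :
    ∀ e ∈ H, N.resetGlobalKernel π k (Sum.inr e) = N.resetGlobalKernel π k' (Sum.inr e) := by
  intro e
  induction e using N.wellFounded_adj.induction with
  | _ e ih =>
    intro he
    by_cases ht : N.tail e ∈ N.terminals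
    · rw [N.resetGlobalKernel_inr_of_mem _ ht, N.resetGlobalKernel_inr_of_mem _ ht, hk e he]
    · rw [N.resetGlobalKernel_inr_of_notMem _ ht, N.resetGlobalKernel_inr_of_notMem _ ht, hk e he]
      congr 1
      refine N.encodingMap_congr fun d hd => ?_
      rcases d with j | d
      · rfl
      · exact ih d hd (hH e he ht d hd)

theorem encodingMap_source_surjective {f : Fin w ⊕ E → Fin w → F}
    (hf : ∀ j, f (Sum.inl j) = Pi.single j 1) :
    Function.Surjective (N.encodingMap f N.source) := by
  rw [← LinearMap.range_eq_top, range_encodingMap, eq_top_iff, ← (Pi.basisFun F (Fin w)).span_eq]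
  refine Submodule.span_mono ?_
  rintro _ ⟨j, rfl⟩
  exact ⟨Sum.inl j, rfl, by rw [hf, Pi.basisFun_apply]⟩

/-- Decoding at all sinks is at least as likely as in the network with reset kernels. -/
theorem unifProb_resetGlobalKernel_le [DecidableEq E] [Fintype F]
    (hπ : ∀ v ∈ N.terminals, Function.Surjective (π v)) :
    unifProb (fun k : N.LocalCoding F w =>
      ∀ t ∈ N.sinks, Function.Surjective (N.encodingMap (N.resetGlobalKernel π k) t)) ≤
    unifProb (fun k : N.LocalCoding F w =>
      ∀ t ∈ N.sinks, Function.Surjective (N.encodingMap (N.globalKernel k) t)) := by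
  classical
  -- The automorphism is chosen from the kernels `g` alone, not from the coefficients; this is what
  -- makes `Θ` injective. The identity is the default at internal nodes, whose channels are not
  -- reset.
  let ρ (g : Fin w ⊕ E → Fin w → F) (v : V) : (N.In w v → F) ≃ₗ[F] (N.In w v → F) :=
    if h : v ∈ N.terminals ∧ ∃ ρ : (N.In w v → F) ≃ₗ[F] (N.In w v → F),
      ∀ x, N.encodingMap g v (ρ x) = π v x then h.2.choose else LinearEquiv.refl F _
  have hρ (g : Fin w ⊕ E → Fin w → F) (v : V) (hv : v ∈ N.terminals)
      (hg : Function.Surjective (N.encodingMap g v)) (x : N.In w v → F) :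
      N.encodingMap g v (ρ g v x) = π v x := by
    have h : v ∈ N.terminals ∧ ∃ ρ : (N.In w v → F) ≃ₗ[F] (N.In w v → F),
      ∀ x, N.encodingMap g v (ρ x) = π v x :=
      ⟨hv, LinearMap.exists_linearEquiv_comp_eq _ _ hg (hπ v hv)⟩
    simp only [ρ, dif_pos h]
    exact h.2.choose_spec x
  have hρ' (g : Fin w ⊕ E → Fin w → F) (v : V) (hv : v ∉ N.terminals) :
      ρ g v = LinearEquiv.refl F _ := dif_neg fun h => hv h.1
  let Θ (k : N.LocalCoding F w) : N.LocalCoding F w :=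
    fun e => ρ (N.resetGlobalKernel π k) (N.tail e) (k e)
  have hΘ (k : N.LocalCoding F w)
      (hk : ∀ t ∈ N.sinks, Function.Surjective (N.encodingMap (N.resetGlobalKernel π k) t))
      (e : E) : N.globalKernel (Θ k) (Sum.inr e) = N.resetGlobalKernel π k (Sum.inr e) := by
    induction e using N.wellFounded_adj.induction with
    | _ e ih =>
      have h : N.encodingMap (N.globalKernel (Θ k)) (N.tail e) =
          N.encodingMap (N.resetGlobalKernel π k) (N.tail e) := by
        refine N.encodingMap_congr fun d hd => ?_
        rcases d with j | d
        · rfl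
        · exact ih d hd
      rw [globalKernel_inr_eq_encodingMap, h]
      by_cases ht : N.tail e ∈ N.terminals
      · rw [N.resetGlobalKernel_inr_of_mem _ ht]
        refine hρ _ _ ht ?_ _
        rcases Finset.mem_insert.1 ht with hs | hs
        · rw [hs]
          exact N.encodingMap_source_surjective fun j => rfl
        · exact hk _ hs
      · rw [N.resetGlobalKernel_inr_of_notMem _ ht]
        simp only [Θ, hρ' _ _ ht]
        rfl
  have hΘ' (k : N.LocalCoding F w)
      (hk : ∀ t ∈ N.sinks, Function.Surjective (N.encodingMap (N.resetGlobalKernel π k) t)) :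
      N.globalKernel (Θ k) = N.resetGlobalKernel π k := by
    funext d
    rcases d with j | d
    · rfl
    · exact hΘ k hk d
  refine unifProb_le_of_injOn Θ (fun k hk => ?_) fun k hk k' hk' h => ?_
  · rw [hΘ' k hk]
    exact hk
  -- `Θ k` determines its own global kernels, which are the reset kernels of `k`; these determine
  -- `ρ`, and `ρ` can be undone.
  · have h' : N.resetGlobalKernel π k = N.resetGlobalKernel π k' := by
      rw [← hΘ' k hk, ← hΘ' k' hk', h]
    funext e
    have := congrFun h e
    simp only [Θ, h'] at this
    exact (ρ _ _).injective this

end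

end CodingNetwork

/-! ### Merging the sinks with the source: initial sets and flows -/

namespace CodingNetwork

variable {V E : Type*} {N : CodingNetwork V E}

theorem tail_ne_head (e : E) : N.tail e ≠ N.head e := fun h =>
  N.acyclic (N.tail e) (.single ⟨e, rfl, h.symm⟩)

variable (N) [DecidableEq V]

/-- The tail of a channel after merging the sinks, as senders, with the source. -/
def mergedTail (e : E) : V := if N.tail e ∈ N.terminals then N.source else N.tail e

/-- A set of internal nodes closed under predecessors, together with the source, or nothing. -/
structure IsInitial (P : Finset V) : Prop where
  notMem_sinks : ∀ v ∈ P, v ∉ N.sinks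
  source_mem : P.Nonempty → N.source ∈ P
  mergedTail_mem : ∀ e, N.head e ∈ P → N.head e ≠ N.source → N.mergedTail e ∈ P

/-- A set of channels forming a flow of value `w` from the source, merged with the sinks as
senders, to the sink `t`. -/
structure IsSinkFlow (w : ℕ) (t : V) (A : Finset E) : Prop where
  head_ne : ∀ e ∈ A, N.head e ≠ N.source
  netOut_eq : ∀ v, netOut N.mergedTail N.head A v =
    (if v = N.source then (w : ℤ) else 0) - (if v = t then (w : ℤ) else 0)

/-- The channels of `A` leaving `P`. -/
def frontier (A : Finset E) (P : Finset V) : Finset E :=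
  A.filter fun e => N.mergedTail e ∈ P ∧ N.head e ∉ P

variable {N}

theorem mergedTail_of_notMem {e : E} (h : N.tail e ∉ N.terminals) :
    N.mergedTail e = N.tail e := if_neg h

theorem mergedTail_of_mem {e : E} (h : N.tail e ∈ N.terminals) :
    N.mergedTail e = N.source := if_pos h

theorem source_mem_terminals : N.source ∈ N.terminals := Finset.mem_insert_self _ _

theorem tail_notMem_terminals {e : E} (h : N.mergedTail e ≠ N.source) :
    N.tail e ∉ N.terminals := fun h' => h (mergedTail_of_mem h')

theorem tail_mem_terminals {e : E} (h : N.mergedTail e = N.source) :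
    N.tail e ∈ N.terminals := by
  by_contra h'
  rw [mergedTail_of_notMem h'] at h
  exact h' (h ▸ source_mem_terminals)

theorem mergedTail_notMem_sinks (e : E) : N.mergedTail e ∉ N.sinks := by
  by_cases h : N.tail e ∈ N.terminals
  · rw [mergedTail_of_mem h]
    exact N.source_notMem_sinks
  · rw [mergedTail_of_notMem h]
    exact fun h' => h (Finset.mem_insert_of_mem h')

/-- By acyclicity some node of `P` other than the source reaches no other such node, and it can be
removed last-in-first-out. The source goes only when it is alone. This supplies the topological
order for the induction. -/
theorem IsInitial.exists_erase [Finite V] [Finite E] {P : Finset V} (hP : N.IsInitial P)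
    (hne : P.Nonempty) : ∃ v ∈ P, N.IsInitial (P.erase v) := by
  rcases (P.erase N.source).eq_empty_or_nonempty with h | h
  · refine ⟨N.source, hP.source_mem hne, ?_⟩
    rw [h]
    exact ⟨by simp, by simp, by simp⟩
  · let r : V → V → Prop :=
      Relation.TransGen (fun x y => ∃ e : E, N.tail e = x ∧ N.head e = y)
    let r' : V → V → Prop := fun x y => r y x
    have : IsTrans V r' := ⟨fun _ _ _ h₁ h₂ => h₂.trans h₁⟩
    have : Std.Irrefl r' := ⟨N.acyclic⟩
    obtain ⟨v, hv, hmin⟩ := (Finite.wellFounded_of_trans_of_irrefl r').has_min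
      (P.erase N.source : Set V) (by exact_mod_cast h)
    have hv' := Finset.mem_erase.1 (Finset.mem_coe.1 hv)
    refine ⟨v, hv'.2, fun x hx => hP.notMem_sinks x (Finset.mem_of_mem_erase hx), fun _ =>
      Finset.mem_erase.2 ⟨hv'.1.symm, hP.source_mem hne⟩, fun e he hs => Finset.mem_erase.2
      ⟨fun hev => ?_, hP.mergedTail_mem e (Finset.mem_of_mem_erase he) hs⟩⟩
    have ht := tail_notMem_terminals (hev.trans_ne hv'.1)
    rw [mergedTail_of_notMem ht] at hev
    exact hmin (N.head e) (Finset.mem_coe.2 (Finset.mem_erase.2 ⟨hs, Finset.mem_of_mem_erase he⟩))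
      (.single ⟨e, hev, rfl⟩)

/-- There are no loops at `v`, so all inputs of an internal node `v` come from `P`; their kernels
are settled before `v` is visited. -/
theorem mergedTail_mem_of_head_eq_tail {P : Finset V} {v : V}
    (hPv : N.IsInitial (insert v P)) {d e : E} (he : N.tail e ∉ N.terminals)
    (hev : N.mergedTail e = v) (hd : N.head d = N.tail e) : N.mergedTail d ∈ P := by
  have hv : N.tail e = v := mergedTail_of_notMem he ▸ hev
  have hds : N.head d ≠ N.source := fun h => he (hd ▸ h ▸ source_mem_terminals)
  refine (Finset.mem_insert.1 (hPv.mergedTail_mem d (by simp [hd, hv]) hds)).resolve_left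
    fun h => ?_
  have hd' : N.tail d ∉ N.terminals := tail_notMem_terminals fun h' => hds (by rw [hd, hv, ← h, h'])
  rw [mergedTail_of_notMem hd'] at h
  exact tail_ne_head d (by rw [h, hd, hv])

theorem isInitial_insert_source_internalNodes [Fintype V] :
    N.IsInitial (insert N.source N.internalNodes) := by
  refine ⟨fun v hv => ?_, fun _ => Finset.mem_insert_self _ _, fun e _ _ => ?_⟩
  · rcases Finset.mem_insert.1 hv with rfl | hv
    · exact N.source_notMem_sinks
    · exact (Finset.mem_filter.1 hv).2.2
  · by_cases h : N.mergedTail e = N.source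
    · rw [h]
      exact Finset.mem_insert_self _ _
    · exact Finset.mem_insert_of_mem
        (Finset.mem_filter.2 ⟨Finset.mem_univ _, h, mergedTail_notMem_sinks e⟩)

/-- After merging, no channel starts at a sink, so by conservation a flow cannot enter any sink but
its own target. -/
theorem IsSinkFlow.eq_of_head_mem_sinks {w : ℕ} {t : V} {A : Finset E} (hA : N.IsSinkFlow w t A)
    {e : E} (he : e ∈ A) (hs : N.head e ∈ N.sinks) : N.head e = t := by
  by_contra h
  have h₁ := hA.netOut_eq (N.head e)
  rw [if_neg (hA.head_ne e he), if_neg h, netOut_eq_card_sub_card,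
    Finset.filter_false_of_mem fun d _ (hd : N.mergedTail d = N.head e) =>
      mergedTail_notMem_sinks d (hd ▸ hs)] at h₁
  have h₂ : 0 < (A.filter fun d => N.head d = N.head e).card :=
    Finset.card_pos.2 ⟨e, Finset.mem_filter.2 ⟨he, rfl⟩⟩
  simp only [Finset.card_empty] at h₁
  omega

theorem IsSinkFlow.head_notMem_insert {w : ℕ} {t : V} {A : Finset E} (hA : N.IsSinkFlow w t A)
    {P : Finset V} {v : V} (hP : N.IsInitial P) (hvP : v ∉ P) {e : E} (he : e ∈ A)
    (hev : N.mergedTail e = v) : N.head e ∉ insert v P := by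
  intro h
  have hes := hA.head_ne e he
  rcases Finset.mem_insert.1 h with h | h
  · have hT := tail_notMem_terminals (e := e) fun h' => hes (by rw [h, ← hev, h'])
    rw [mergedTail_of_notMem hT] at hev
    exact tail_ne_head e (hev.trans h.symm)
  · exact hvP (hev ▸ hP.mergedTail_mem e h hes)

theorem IsSinkFlow.head_eq_of_notMem [Fintype V] {w : ℕ} {t : V} {A : Finset E}
    (hA : N.IsSinkFlow w t A) {e : E}
    (he : e ∈ A) (hh : N.head e ∉ insert N.source N.internalNodes) : N.head e = t := by
  refine hA.eq_of_head_mem_sinks he ?_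
  by_contra h
  refine hh (Finset.mem_insert_of_mem ?_)
  exact Finset.mem_filter.2 ⟨Finset.mem_univ _, hA.head_ne e he, h⟩

variable [Fintype E]

/-- A cut `U` of the merged network is compared with the cut `U ∪ (T \ {t})` of the original one:
every channel leaving the latter also leaves `U` after merging and does not enter the source. -/
theorem exists_isSinkFlow [Fintype V] [DecidableEq E] {w : ℕ} {t : V}
    (hw : w ≤ N.minCut t) : ∃ A, N.IsSinkFlow w t A := by
  have hcut (U : Finset V) (hs : N.source ∈ U) (htU : t ∉ U) :
      w ≤ ((Finset.univ.filter fun e => N.head e ≠ N.source).filter fun e =>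
        N.mergedTail e ∈ U ∧ N.head e ∉ U).card := by
    have hcut : N.minCut t ≤ N.cutCapacity (U ∪ N.sinks.erase t) :=
      Nat.sInf_le ⟨_, Finset.mem_union_left _ hs, by simp [htU], rfl⟩
    refine (hw.trans hcut).trans (Finset.card_le_card fun e he => ?_)
    simp only [Finset.mem_filter, Finset.mem_univ, true_and, Finset.mem_union, not_or] at he ⊢
    refine ⟨fun h => he.2.1 (h ▸ hs), ?_, he.2.1⟩
    by_cases h : N.tail e ∈ N.terminals
    · rwa [mergedTail_of_mem h]
    · rw [mergedTail_of_notMem h]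
      exact he.1.resolve_right fun h' =>
        h (Finset.mem_insert_of_mem (Finset.mem_of_mem_erase h'))
  obtain ⟨A, hAB, hA⟩ := exists_unit_flow N.mergedTail N.head _ N.source t w hcut
  exact ⟨A, fun e he => (Finset.mem_filter.1 (hAB he)).2, hA⟩

theorem le_card_head_eq [Fintype V] {w : ℕ} {t : V} (ht : t ∈ N.sinks) (hw : w ≤ N.minCut t) :
    w ≤ (Finset.univ.filter fun e => N.head e = t).card := by
  have hts : N.source ≠ t := fun h => N.source_notMem_sinks (h ▸ ht)
  have hcut : N.minCut t ≤ N.cutCapacity (Finset.univ.erase t) :=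
    Nat.sInf_le ⟨_, by simp [hts], by simp, rfl⟩
  refine (hw.trans hcut).trans (Finset.card_le_card fun e he => ?_)
  simpa using (Finset.mem_filter.1 he).2.2

/-- A terminal has at least `w` incoming channels, the imaginary ones at the source and those
counted by the cut `V \ {t}` at a sink, so a projection onto `w` coordinates will do. -/
theorem exists_surjective_of_mem_terminals [Fintype V] {F : Type*} [Field F] {w : ℕ}
    (hw : ∀ t ∈ N.sinks, w ≤ N.minCut t) :
    ∃ π : ∀ v, (N.In w v → F) →ₗ[F] (Fin w → F),
      ∀ v ∈ N.terminals, Function.Surjective (π v) := by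
  have h (v : V) : ∃ π : (N.In w v → F) →ₗ[F] (Fin w → F),
      v ∈ N.terminals → Function.Surjective π := by
    by_cases hv : v ∈ N.terminals
    · have : Nonempty (Fin w ↪ N.In w v) := by
        rcases Finset.mem_insert.1 hv with rfl | hv
        · exact ⟨fun j => ⟨Sum.inl j, rfl⟩, fun i j h =>
            Sum.inl_injective (Subtype.ext_iff.1 h)⟩
        · refine Function.Embedding.nonempty_of_card_le ?_
          rw [Fintype.card_fin]
          refine (le_card_head_eq hv (hw v hv)).trans ?_
          rw [← Fintype.card_subtype]
          exact Fintype.card_le_of_injective (fun e => ⟨Sum.inr e.1, e.2⟩)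
            fun e e' h => by simpa [Subtype.ext_iff] using h
      obtain ⟨ι⟩ := this
      exact ⟨LinearMap.funLeft F F ι, fun _ =>
        LinearMap.funLeft_surjective_of_injective F F ι ι.injective⟩
    · exact ⟨0, fun h => absurd h hv⟩
  choose π hπ using h
  exact ⟨π, hπ⟩

/-! ### Propagating the spanning property past one node -/

section Spans

variable {F : Type*} [Field F] {w : ℕ} (N)

/-- The reset kernels of the channels of `A` leaving `P` span the whole space (no condition for
`P = ∅`). -/
def Spans (π : ∀ v, (N.In w v → F) →ₗ[F] (Fin w → F)) (A : Finset E) (P : Finset V)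
    (k : N.LocalCoding F w) : Prop :=
  P.Nonempty → Submodule.span F
    ((fun e => N.resetGlobalKernel π k (Sum.inr e)) '' (N.frontier A P : Set E)) = ⊤

variable {N} {π : ∀ v, (N.In w v → F) →ₗ[F] (Fin w → F)}

theorem spans_congr {A : Finset E} {P : Finset V} {k k' : N.LocalCoding F w}
    (h : ∀ e ∈ N.frontier A P,
      N.resetGlobalKernel π k (Sum.inr e) = N.resetGlobalKernel π k' (Sum.inr e)) :
    N.Spans π A P k ↔ N.Spans π A P k' := by
  unfold Spans
  rw [Set.image_congr h]

theorem IsInitial.resetGlobalKernel_congr {P : Finset V} (hP : N.IsInitial P)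
    {k k' : N.LocalCoding F w} (hk : ∀ e, N.mergedTail e ∈ P → k e = k' e) :
    ∀ e, N.mergedTail e ∈ P →
      N.resetGlobalKernel π k (Sum.inr e) = N.resetGlobalKernel π k' (Sum.inr e) := by
  refine N.resetGlobalKernel_congr {e | N.mergedTail e ∈ P} (fun e he ht d hd => ?_) hk
  have he' : N.tail e ∈ P := mergedTail_of_notMem ht ▸ he
  exact hP.mergedTail_mem d (hd ▸ he') fun h => ht (hd ▸ h ▸ source_mem_terminals)

/-- Channels leaving `v` do not feed one another, so each depends only on the coefficients at `P`
and its own. This gives the independence used at the last node. -/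
theorem IsInitial.resetGlobalKernel_congr_insert {P : Finset V} {v : V} (hP : N.IsInitial P)
    (hPv : N.IsInitial (insert v P)) {k k' : N.LocalCoding F w}
    (hk : ∀ e, N.mergedTail e ∈ P → k e = k' e) {e : E} (hev : N.mergedTail e = v)
    (he : k e = k' e) :
    N.resetGlobalKernel π k (Sum.inr e) = N.resetGlobalKernel π k' (Sum.inr e) := by
  by_cases ht : N.tail e ∈ N.terminals
  · rw [N.resetGlobalKernel_inr_of_mem _ ht, N.resetGlobalKernel_inr_of_mem _ ht, he]
  · rw [N.resetGlobalKernel_inr_of_notMem _ ht, N.resetGlobalKernel_inr_of_notMem _ ht, he]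
    congr 1
    refine N.encodingMap_congr fun d hd => ?_
    rcases d with j | d
    · rfl
    · exact hP.resetGlobalKernel_congr hk d
        (mergedTail_mem_of_head_eq_tail hPv ht hev hd)

/-- Resampling the coefficients of the channels of the flow leaving the next node `v` preserves
the spanning property with probability at least `1 - a`. -/
theorem IsSinkFlow.le_unifProb_spans_insert [DecidableEq E] [Fintype F] {A : Finset E} {t : V}
    (hA : N.IsSinkFlow w t A) (ht : t ∈ N.sinks)
    (hπ : ∀ v ∈ N.terminals, Function.Surjective (π v)) {P : Finset V} {v : V}
    (hvP : v ∉ P) (hP : N.IsInitial P) (hPv : N.IsInitial (insert v P)) (B : Set E)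
    [∀ e, Decidable (e ∈ B)] (hB : ∀ e ∈ B, N.mergedTail e = v) (hAB : ∀ e ∈ A, N.mergedTail e = v → e ∈ B)
    (k : N.LocalCoding F w) (hk : N.Spans π A P k) :
    1 - codingLoss (Fintype.card F) w ≤
      unifProb fun k' => N.Spans π A (insert v P) (B.piecewise k' k) := by
  have hpw (k' : N.LocalCoding F w) (e : E) (he : N.mergedTail e ∈ P) :
      B.piecewise k' k e = k e :=
    Set.piecewise_eq_of_notMem _ _ _ fun h => hvP (hB e h ▸ he)
  set R := A.filter fun e => N.mergedTail e ∈ P ∧ N.head e ∉ insert v P with hR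
  set O := A.filter fun e => N.mergedTail e = v with hO
  set I := A.filter fun e => N.head e = v with hI
  set κ : E → Fin w → F := fun e => N.resetGlobalKernel π k (Sum.inr e) with hκ
  set Z := Submodule.span F (κ '' (R : Set E)) with hZ
  -- With everything upstream frozen at `k`, the kernel of a channel leaving `v` is a linear
  -- function of its own coefficients.
  let M (e : E) : (N.In w (N.tail e) → F) →ₗ[F] (Fin w → F) :=
    if N.tail e ∈ N.terminals then π (N.tail e)
    else N.encodingMap (N.resetGlobalKernel π k) (N.tail e)
  have hOker (k' : N.LocalCoding F w) (e : E) (he : e ∈ O) :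
      N.resetGlobalKernel π (B.piecewise k' k) (Sum.inr e) = M e (k' e) := by
    obtain ⟨heA, hev⟩ := Finset.mem_filter.1 he
    have heB : B.piecewise k' k e = k' e := Set.piecewise_eq_of_mem _ _ _ (hAB e heA hev)
    by_cases hT : N.tail e ∈ N.terminals
    · simp only [M, if_pos hT]
      rw [N.resetGlobalKernel_inr_of_mem _ hT, heB]
    · simp only [M, if_neg hT]
      rw [N.resetGlobalKernel_inr_of_notMem _ hT, heB]
      congr 1
      refine N.encodingMap_congr fun d hd => ?_
      rcases d with j | d
      · rfl
      · exact hP.resetGlobalKernel_congr (hpw k') d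
          (mergedTail_mem_of_head_eq_tail hPv hT hev hd)
  have hfrontier : R ∪ O ⊆ N.frontier A (insert v P) := by
    intro e he
    rcases Finset.mem_union.1 he with he | he
    · obtain ⟨heA, h₁, h₂⟩ := Finset.mem_filter.1 he
      exact Finset.mem_filter.2 ⟨heA, Finset.mem_insert_of_mem h₁, h₂⟩
    · obtain ⟨heA, hev⟩ := Finset.mem_filter.1 he
      exact Finset.mem_filter.2 ⟨heA, by simp [hev], hA.head_notMem_insert hP hvP heA hev⟩
  have hsub : N.frontier A P ⊆ R ∪ I := by
    intro e he
    obtain ⟨heA, h₁, h₂⟩ := Finset.mem_filter.1 he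
    by_cases h : N.head e = v
    · exact Finset.mem_union_right _ (Finset.mem_filter.2 ⟨heA, h⟩)
    · exact Finset.mem_union_left _ (Finset.mem_filter.2 ⟨heA, h₁, by simp [h, h₂]⟩)
  have hvt : v ≠ t := fun h => hPv.notMem_sinks v (Finset.mem_insert_self _ _) (h ▸ ht)
  have hflow := hA.netOut_eq v
  rw [netOut_eq_card_sub_card, if_neg hvt, ← hO, ← hI] at hflow
  have hspan (hvs : v ≠ N.source) :
      Submodule.span F (κ '' (N.frontier A P : Set E)) = ⊤ :=
    hk ⟨N.source, (Finset.mem_insert.1 (hPv.source_mem (Finset.insert_nonempty _ _))).resolve_left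
      hvs.symm⟩
  -- At an internal node the range contains the kernels of `I`, and together with `Z` these contain
  -- the spanning kernels of the old frontier.
  have hM : ∀ e ∈ O, Z ⊔ LinearMap.range (M e) = ⊤ := by
    intro e he
    obtain ⟨heA, hev⟩ := Finset.mem_filter.1 he
    by_cases hvs : v = N.source
    · have hT := tail_mem_terminals (hev.trans hvs)
      simp only [M, if_pos hT, LinearMap.range_eq_top.2 (hπ _ hT), sup_top_eq]
    · have hT := tail_notMem_terminals (hev.trans_ne hvs)
      rw [mergedTail_of_notMem hT] at hev
      simp only [M, if_neg hT]
      rw [range_encodingMap, hZ, ← Submodule.span_union, eq_top_iff, ← hspan hvs]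
      refine Submodule.span_mono ?_
      rintro _ ⟨d, hd, rfl⟩
      rcases Finset.mem_union.1 (hsub hd) with h | h
      · exact Or.inl ⟨d, h, rfl⟩
      · exact Or.inr ⟨Sum.inr d, (Finset.mem_filter.1 h).2.trans hev.symm, rfl⟩
  -- At the source `I` is empty and conservation gives `|O| = w`. Elsewhere `|O| = |I|`, and
  -- adjoining the kernels of `I` to `Z` gives the whole space.
  have hcodim : Module.finrank F ((Fin w → F) ⧸ Z) ≤ O.card := by
    by_cases hvs : v = N.source
    · have hI0 : I.card = 0 := Finset.card_eq_zero.2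
        (Finset.filter_false_of_mem fun e he h => hA.head_ne e he (h.trans hvs))
      rw [if_pos hvs, hI0] at hflow
      have := Z.finrank_quotient_le
      rw [Module.finrank_fin_fun] at this
      omega
    · rw [if_neg hvs] at hflow
      have h₁ : Z ⊔ Submodule.span F (κ '' (I : Set E)) = ⊤ := by
        rw [hZ, ← Submodule.span_union, ← Set.image_union, eq_top_iff, ← hspan hvs]
        refine Submodule.span_mono (Set.image_mono ?_)
        exact_mod_cast hsub
      have h₂ := Submodule.finrank_add_le_finrank_add_finrank Z (Submodule.span F (κ '' (I : Set E)))
      have h₃ : Module.finrank F (Submodule.span F (κ '' (I : Set E))) ≤ I.card := by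
        classical
        rw [← Finset.coe_image]
        exact (finrank_span_finset_le_card _).trans Finset.card_image_le
      have h₄ := Z.finrank_quotient_add_finrank
      rw [h₁, finrank_top] at h₂
      omega
  have := le_unifProb_sup_span_eq_top Z O M hM hcodim
  rw [Module.finrank_fin_fun] at this
  refine this.trans (unifProb_mono fun k' hk' _ => ?_)
  rw [eq_top_iff, ← hk', hZ, ← Submodule.span_union]
  refine Submodule.span_mono ?_
  rintro _ (⟨e, he, rfl⟩ | ⟨e, he, rfl⟩)
  · exact ⟨e, hfrontier (Finset.mem_union_left _ he),
      hP.resetGlobalKernel_congr (hpw k') e (Finset.mem_filter.1 he).2.1⟩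
  · exact ⟨e, hfrontier (Finset.mem_union_right _ he), hOker k' e he⟩

end Spans

end CodingNetwork

/-! ### Combining the nodes and the final bound -/

namespace CodingNetwork

variable {V E F : Type*} {N : CodingNetwork V E} [DecidableEq V] [Fintype E] [Field F] {w : ℕ} {π : ∀ v, (N.In w v → F) →ₗ[F] (Fin w → F)} {A : V → Finset E}

theorem IsInitial.spans_piecewise {P : Finset V} (hP : N.IsInitial P) (B : Set E)
    [∀ e, Decidable (e ∈ B)] (hB : ∀ e ∈ B, N.mergedTail e ∉ P) (A : Finset E)
    (k k' : N.LocalCoding F w) : N.Spans π A P (B.piecewise k' k) ↔ N.Spans π A P k :=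
  spans_congr fun e he => hP.resetGlobalKernel_congr
    (fun d hd => Set.piecewise_eq_of_notMem _ _ _ fun h => hB d h hd) e (Finset.mem_filter.1 he).2.1

theorem Spans.surjective [Fintype V] {t : V} {A : Finset E} (hA : N.IsSinkFlow w t A)
    {k : N.LocalCoding F w} (hk : N.Spans π A (insert N.source N.internalNodes) k) :
    Function.Surjective (N.encodingMap (N.resetGlobalKernel π k) t) := by
  rw [← LinearMap.range_eq_top, range_encodingMap, eq_top_iff, ← hk (Finset.insert_nonempty _ _)]
  refine Submodule.span_mono ?_
  rintro _ ⟨e, he, rfl⟩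
  obtain ⟨heA, -, h⟩ := Finset.mem_filter.1 he
  exact ⟨Sum.inr e, hA.head_eq_of_notMem heA h, rfl⟩

theorem surjective_encodingMap_iff (k : N.LocalCoding F w) (t : V) :
    Function.Surjective (N.encodingMap (N.globalKernel k) t) ↔
      ¬ (N.decodingMatrix k t).rank < w := by
  have h : (N.decodingMatrix k t).mulVecLin = N.encodingMap (N.globalKernel k) t := by
    ext x i
    simp [encodingMap, Fintype.linearCombination_apply, decodingMatrix, Matrix.mulVec_eq_sum]
  rw [← LinearMap.range_eq_top, ← h, Matrix.rank, not_lt]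
  constructor
  · intro h
    rw [h, finrank_top, Module.finrank_fin_fun]
  · intro h
    refine Submodule.eq_top_of_finrank_eq (le_antisymm (Submodule.finrank_le _) ?_)
    rwa [Module.finrank_fin_fun]

variable [DecidableEq E] [Fintype F]

/-- The union bound over the sinks, applied to every node of an initial set. -/
theorem IsInitial.pow_card_le_unifProb [Finite V] (hA : ∀ t ∈ N.sinks, N.IsSinkFlow w t (A t))
    (hπ : ∀ v ∈ N.terminals, Function.Surjective (π v))
    (hnonneg : 0 ≤ 1 - (N.sinks.card : ℝ) * codingLoss (Fintype.card F) w)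
    {P : Finset V} (hP : N.IsInitial P) :
    (1 - (N.sinks.card : ℝ) * codingLoss (Fintype.card F) w) ^ P.card ≤
      unifProb fun k : N.LocalCoding F w => ∀ t ∈ N.sinks, N.Spans π (A t) P k := by
  classical
  induction hn : P.card generalizing P with
  | zero =>
    rw [Finset.card_eq_zero] at hn
    subst hn
    rw [unifProb_of_forall, pow_zero]
    exact fun k t _ h => absurd h Finset.not_nonempty_empty
  | succ n ih =>
    obtain ⟨v, hv, hPv⟩ := hP.exists_erase (Finset.card_pos.1 (by omega))
    have hn' : (P.erase v).card = n := by rw [Finset.card_erase_of_mem hv, hn, Nat.add_sub_cancel]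
    have hins : insert v (P.erase v) = P := Finset.insert_erase hv
    -- All channels leaving `v` are resampled at once, as flows to different sinks may share them;
    -- hence the union bound.
    obtain ⟨B, hB⟩ : ∃ B : Set E, ∀ e, e ∈ B ↔ N.mergedTail e = v := ⟨{e | _}, fun e => Iff.rfl⟩
    have hBP : ∀ e ∈ B, N.mergedTail e ∉ P.erase v :=
      fun e he => (hB e).1 he ▸ Finset.notMem_erase _ _
    have hstep (k : N.LocalCoding F w) (hk : ∀ t ∈ N.sinks, N.Spans π (A t) (P.erase v) k) :
        1 - (N.sinks.card : ℝ) * codingLoss (Fintype.card F) w ≤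
          unifProb fun k' : N.LocalCoding F w =>
            ∀ t ∈ N.sinks, N.Spans π (A t) P (B.piecewise k' k) := by
      refine one_sub_card_mul_le_unifProb_forall N.sinks
        (fun t (k' : N.LocalCoding F w) => N.Spans π (A t) P (B.piecewise k' k)) fun t ht => ?_
      have := (hA t ht).le_unifProb_spans_insert ht hπ (Finset.notMem_erase v P) hPv
        (hins.symm ▸ hP) B (fun e he => (hB e).1 he) (fun e _ he => (hB e).2 he) k (hk t ht)
      rwa [hins] at this
    have hinv (k k' : N.LocalCoding F w)
        (hk : ∀ t ∈ N.sinks, N.Spans π (A t) (P.erase v) k) :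
        ∀ t ∈ N.sinks, N.Spans π (A t) (P.erase v) (B.piecewise k' k) :=
      fun t ht => (hPv.spans_piecewise B hBP _ _ _).2 (hk t ht)
    have := mul_unifProb_le_unifProb_and (X := fun e => N.In w (N.tail e) → F) B
      (G := fun k => ∀ t ∈ N.sinks, N.Spans π (A t) (P.erase v) k)
      (G' := fun k => ∀ t ∈ N.sinks, N.Spans π (A t) P k) hinv hstep
    rw [pow_succ']
    exact (mul_le_mul_of_nonneg_left (ih hPv hn') hnonneg).trans
      (this.trans (unifProb_mono fun k hk => hk.2))

/-- At the last node, the sinks depend on disjoint sets of coefficients. -/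
theorem IsInitial.pow_mul_unifProb_le [Fintype V] (hA : ∀ t ∈ N.sinks, N.IsSinkFlow w t (A t))
    (hπ : ∀ v ∈ N.terminals, Function.Surjective (π v)) {P : Finset V} {v : V} (hvP : v ∉ P)
    (hP : N.IsInitial P) (hPv : insert v P = insert N.source N.internalNodes) :
    (1 - codingLoss (Fintype.card F) w) ^ N.sinks.card *
      unifProb (fun k : N.LocalCoding F w => ∀ t ∈ N.sinks, N.Spans π (A t) P k) ≤
    unifProb fun k : N.LocalCoding F w =>
      ∀ t ∈ N.sinks, N.Spans π (A t) (insert N.source N.internalNodes) k := by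
  classical
  have hins : N.IsInitial (insert v P) := hPv ▸ isInitial_insert_source_internalNodes
  have ha := (codingLoss_mem_Icc F w).2
  have key (T : Finset V) (hT : T ⊆ N.sinks) :
      (1 - codingLoss (Fintype.card F) w) ^ T.card *
        unifProb (fun k : N.LocalCoding F w => ∀ t ∈ N.sinks, N.Spans π (A t) P k) ≤
      unifProb fun k : N.LocalCoding F w => (∀ t ∈ N.sinks, N.Spans π (A t) P k) ∧
        ∀ t ∈ T, N.Spans π (A t) (insert v P) k := by
    induction T using Finset.induction_on with
    | empty => simp
    | insert t T htT ih =>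
      have ht : t ∈ N.sinks := hT (Finset.mem_insert_self _ _)
      have hT' : T ⊆ N.sinks := (Finset.subset_insert _ _).trans hT
      -- Only the channels from `v` to `t` are resampled. No unvisited internal node is left, so
      -- these include all channels of the flow to `t` leaving `v`, and none of those for the sinks
      -- already treated.
      obtain ⟨B, hB⟩ : ∃ B : Set E, ∀ e, e ∈ B ↔ N.mergedTail e = v ∧ N.head e = t :=
        ⟨{e | _}, fun e => Iff.rfl⟩
      have hBP : ∀ e ∈ B, N.mergedTail e ∉ P := fun e he => ((hB e).1 he).1 ▸ hvP
      have hstep (k : N.LocalCoding F w) (hk : (∀ t ∈ N.sinks, N.Spans π (A t) P k) ∧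
          ∀ t ∈ T, N.Spans π (A t) (insert v P) k) :
          1 - codingLoss (Fintype.card F) w ≤
            unifProb fun k' : N.LocalCoding F w =>
              N.Spans π (A t) (insert v P) (B.piecewise k' k) := by
        refine (hA t ht).le_unifProb_spans_insert ht hπ hvP hP hins B (fun e he => ((hB e).1 he).1)
          (fun e he hev => (hB e).2 ⟨hev, (hA t ht).head_eq_of_notMem he ?_⟩) k (hk.1 t ht)
        rw [← hPv]
        exact (hA t ht).head_notMem_insert hP hvP he hev
      have hinv (k k' : N.LocalCoding F w) (hk : (∀ t ∈ N.sinks, N.Spans π (A t) P k) ∧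
          ∀ t ∈ T, N.Spans π (A t) (insert v P) k) :
          (∀ t ∈ N.sinks, N.Spans π (A t) P (B.piecewise k' k)) ∧
            ∀ t ∈ T, N.Spans π (A t) (insert v P) (B.piecewise k' k) := by
        refine ⟨fun t ht => (hP.spans_piecewise B hBP _ _ _).2 (hk.1 t ht),
          fun t' ht' => (spans_congr fun e he => ?_).2 (hk.2 t' ht')⟩
        obtain ⟨heA, h₁, h₂⟩ := Finset.mem_filter.1 he
        have hk' (d : E) (hd : N.mergedTail d ∈ P) : B.piecewise k' k d = k d :=
          Set.piecewise_eq_of_notMem _ _ _ fun h => hBP d h hd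
        rcases Finset.mem_insert.1 h₁ with h₁ | h₁
        · refine hP.resetGlobalKernel_congr_insert hins hk' h₁
            (Set.piecewise_eq_of_notMem _ _ _ fun h => htT ?_)
          have := (hA t' (hT' ht')).head_eq_of_notMem heA (hPv ▸ h₂)
          rwa [← ((hB e).1 h).2, this]
        · exact hP.resetGlobalKernel_congr hk' e h₁
      have := mul_unifProb_le_unifProb_and (X := fun e => N.In w (N.tail e) → F) B
        (G := fun k => (∀ t ∈ N.sinks, N.Spans π (A t) P k) ∧
          ∀ t ∈ T, N.Spans π (A t) (insert v P) k)
        (G' := fun k => N.Spans π (A t) (insert v P) k) hinv hstep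
      rw [Finset.card_insert_of_notMem htT, pow_succ', mul_assoc]
      refine (mul_le_mul_of_nonneg_left (ih hT') (by linarith)).trans
        (this.trans (unifProb_mono fun k hk => ⟨hk.1.1, fun t' ht' => ?_⟩))
      rcases Finset.mem_insert.1 ht' with rfl | ht'
      · exact hk.2
      · exact hk.1.2 t' ht'
  rw [← hPv]
  exact (key N.sinks subset_rfl).trans (unifProb_mono fun k hk => hk.2)

theorem failureProb_eq_one_sub :
    N.failureProb F w = 1 - unifProb fun k : N.LocalCoding F w =>
      ∀ t ∈ N.sinks, Function.Surjective (N.encodingMap (N.globalKernel k) t) := by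
  classical
  have h : N.failureProb F w = unifProb fun k : N.LocalCoding F w =>
      ∃ t ∈ N.sinks, (N.decodingMatrix k t).rank < w := by
    rw [failureProb, PMF.toOuterMeasure_uniformOfFintype_apply, ENNReal.toReal_div,
      ENNReal.toReal_natCast, ENNReal.toReal_natCast, unifProb_eq_div, ← Fintype.card_subtype]
    rfl
  rw [h, ← unifProb_not]
  congr 1
  funext k
  simp only [surjective_encodingMap_iff]
  push Not
  rfl

/-- The bound for `m = |J|`. -/
theorem failureProb_le_of_nonneg [Fintype V] (hw : ∀ t ∈ N.sinks, w ≤ N.minCut t)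
    (h : 0 ≤ 1 - (N.sinks.card : ℝ) * codingLoss (Fintype.card F) w ∨ N.internalNodes.card = 0) :
    N.failureProb F w ≤ 1 - (1 - codingLoss (Fintype.card F) w) ^ N.sinks.card *
      (1 - (N.sinks.card : ℝ) * codingLoss (Fintype.card F) w) ^ N.internalNodes.card := by
  classical
  obtain ⟨π, hπ⟩ := exists_surjective_of_mem_terminals (F := F) hw
  have hflow (t : V) : ∃ A, t ∈ N.sinks → N.IsSinkFlow w t A := by
    by_cases ht : t ∈ N.sinks
    · obtain ⟨A, hA⟩ := exists_isSinkFlow (hw t ht)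
      exact ⟨A, fun _ => hA⟩
    · exact ⟨∅, fun h => absurd h ht⟩
  choose A hA using hflow
  obtain ⟨v, hv, hP⟩ := (isInitial_insert_source_internalNodes (N := N)).exists_erase
    (Finset.insert_nonempty _ _)
  -- Removing the last node leaves `|J|` nodes, which is the exponent of `1 - la`. If `J` is empty
  -- the last node is the source and `P = ∅`, so the sign of `1 - la` plays no role.
  set P := (insert N.source N.internalNodes).erase v with hPdef
  have hcard : P.card = N.internalNodes.card := by
    rw [Finset.card_erase_of_mem hv, Finset.card_insert_of_notMem (by simp [internalNodes]),
      Nat.add_sub_cancel]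
  have h₁ : (1 - (N.sinks.card : ℝ) * codingLoss (Fintype.card F) w) ^ N.internalNodes.card ≤
      unifProb fun k : N.LocalCoding F w => ∀ t ∈ N.sinks, N.Spans π (A t) P k := by
    rcases h with h | h
    · rw [← hcard]
      exact hP.pow_card_le_unifProb hA hπ h
    · rw [h, pow_zero, unifProb_of_forall]
      rw [h, Finset.card_eq_zero] at hcard
      intro k t _ hne
      exact absurd hne (hcard ▸ Finset.not_nonempty_empty)
  have h₂ := hP.pow_mul_unifProb_le hA hπ (Finset.notMem_erase _ _) (Finset.insert_erase hv)
  have h₃ : unifProb (fun k : N.LocalCoding F w =>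
      ∀ t ∈ N.sinks, N.Spans π (A t) (insert N.source N.internalNodes) k) ≤
      unifProb fun k : N.LocalCoding F w =>
        ∀ t ∈ N.sinks, Function.Surjective (N.encodingMap (N.resetGlobalKernel π k) t) :=
    unifProb_mono fun k hk t ht => (hk t ht).surjective (hA t ht)
  have h₄ := N.unifProb_resetGlobalKernel_le hπ
  have ha := (codingLoss_mem_Icc F w).2
  have h₅ := mul_le_mul_of_nonneg_left h₁
    (pow_nonneg (sub_nonneg.2 ha) N.sinks.card)
  rw [failureProb_eq_one_sub]
  linarith

/-- If `la ≤ 1`, the base `1 - la` lies in `[0, 1]` and the exponent may grow from `|J|` to `m`. If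
`la > 1`, an odd `m` makes the power nonpositive and the bound at least `1`, while `m = 0` forces
`J` to be empty. -/
theorem failureProb_le [Fintype V] (hw : ∀ t ∈ N.sinks, w ≤ N.minCut t) {m : ℕ}
    (hm : N.internalNodes.card ≤ m)
    (h : (N.sinks.card : ℝ) * codingLoss (Fintype.card F) w ≤ 1 ∨ m = 0 ∨ Odd m) :
    N.failureProb F w ≤ 1 - (1 - codingLoss (Fintype.card F) w) ^ N.sinks.card *
      (1 - (N.sinks.card : ℝ) * codingLoss (Fintype.card F) w) ^ m := by
  obtain ⟨ha₀, ha₁⟩ := codingLoss_mem_Icc F w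
  have hpow := pow_nonneg (sub_nonneg.2 ha₁) N.sinks.card
  by_cases hla : (N.sinks.card : ℝ) * codingLoss (Fintype.card F) w ≤ 1
  · refine (failureProb_le_of_nonneg hw (Or.inl (sub_nonneg.2 hla))).trans ?_
    have : 0 ≤ (N.sinks.card : ℝ) * codingLoss (Fintype.card F) w := by positivity
    have := pow_le_pow_of_le_one (sub_nonneg.2 hla) (by linarith) hm
    have := mul_le_mul_of_nonneg_left this hpow
    linarith
  · rcases h.resolve_left hla with rfl | hodd
    · have hJ := Nat.le_zero.1 hm
      have := failureProb_le_of_nonneg (F := F) hw (Or.inr hJ)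
      rwa [hJ] at this
    · have h₁ : N.failureProb F w ≤ 1 := by
        rw [failureProb_eq_one_sub]
        linarith [unifProb_nonneg fun k : N.LocalCoding F w =>
          ∀ t ∈ N.sinks, Function.Surjective (N.encodingMap (N.globalKernel k) t)]
      have h₂ := mul_nonpos_of_nonneg_of_nonpos hpow
        (hodd.pow_nonpos (sub_nonpos.2 (not_le.1 hla).le))
      linarith

end CodingNetwork

theorem theorem5 {V E F : Type*} [Fintype V] [DecidableEq V] [Fintype E] [DecidableEq E]
    [Field F] [Fintype F] (N : CodingNetwork V E) (w : ℕ)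
    (hw : ∀ t ∈ N.sinks, w ≤ N.minCut t) (l : ℕ) (hl : N.sinks.card = l)
    (a : ℝ) (ha : a = codingLoss (Fintype.card F) w) :
    (∀ m : ℕ, N.internalNodes.card ≤ m → ((l : ℝ) * a ≤ 1 ∨ m = 0 ∨ Odd m) →
      N.failureProb F w ≤ 1 - (1 - a) ^ l * (1 - (l : ℝ) * a) ^ m) ∧
    (((l : ℝ) * a ≤ 1 ∨ N.internalNodes.card = 0 ∨ Odd N.internalNodes.card) →
      N.failureProb F w ≤
        1 - (1 - a) ^ N.sinks.card *
          (1 - (N.sinks.card : ℝ) * a) ^ N.internalNodes.card) := by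
  subst hl ha
  exact ⟨fun m hm h => CodingNetwork.failureProb_le hw hm h,
    fun h => CodingNetwork.failureProb_le hw le_rfl h⟩
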